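/- All Hilbert spaces are finite-dimensional and complex, and $\log$ is to base $2$, with $-\log 0=+\infty$. For a Hilbert space $\mathcal H$ let $\mathcal P(\mathcal H)$ be the set of non-negative (not necessarily normalized) operators on $\mathcal H$; a density operator is a $\rho\in\mathcal P(\mathcal H)$ with $\operatorname{Tr}\rho=1$. Write $\|A\|:=\operatorname{Tr}\sqrt{A^*A}$. For $\rho_{AB}\in\mathcal P(\mathcal H_A\otimes\mathcal H_B)$ and a density operator $\sigma_B$ on $\mathcal H_B$, let $H_{\min}(\rho_{AB}|\sigma_B):=-\log\lambda$, where $\lambda$ is the minimum real number such that $\lambda\cdot \mathrm{id}_A\otimes\sigma_B-\rho_{AB}\ge 0$, and $H_{\min}(\rho_{AB}|\sigma_B):=-\infty$ if no such $\lambda$ exists. For $\varepsilon\ge 0$ let $$H_{\min}^{\varepsilon}(\rho_{AB}|\sigma_B):=\sup_{\bar\rho_{AB}}H_{\min}(\bar\rho_{AB}|\sigma_B),\qquad H_{\min}^{\varepsilon}(\rho_{AB}|B):=\sup_{\sigma_B}H_{\min}^{\varepsilon}(\rho_{AB}|\sigma_B),$$ where $\bar\rho_{AB}$ ranges over all $\bar\rho_{AB}\in\mathcal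 P(\mathcal H_A\otimes\mathcal H_B)$ with $\|\bar\rho_{AB}-\rho_{AB}\|\le(\operatorname{Tr}\rho_{AB})\,\varepsilon$, and $\sigma_B$ over all density operators on $\mathcal H_B$. These quantities take values in $[-\infty,+\infty]$. Let $H_{\max}(\rho_A):=\log\operatorname{rank}(\rho_A)$. An operator $\rho_{XA}\in\mathcal P(\mathcal H_X\otimes\mathcal H_A)$ is called classical on $\mathcal H_X$ if $\rho_{XA}=\sum_x P(x)\,|x\rangle\langle x|\otimes\rho_A^x$ for some orthonormal basis $\{|x\rangle\}$ of $\mathcal H_X$, some numbers $P(x)\ge 0$ and some $\rho_A^x\in\mathcal P(\mathcal H_A)$. **Corollary.** Let $\rho_{XBC}\in\mathcal P(\mathcal H_X\otimes\mathcal H_B\otimes\mathcal H_C)$ be a density operator that is classical on $\mathcal H_X$, and let $\rho_{BC}=\operatorname{Tr}_X\rho_{XBC}$ and $\rho_X=\operatorname{Tr}_{BC}\rho_{XBC}$. Then, for every $\varepsilon\ge 0$, $$H_{\min}^{\bar\varepsilon}(\rho_{XBC}|XC)\ \ge\ H_{\min}^{\varepsilon}(\rho_{BC}|C)-H_{\max}(\rho_X),\qquad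 \bar\varepsilon:=\sqrt{8\varepsilon}.$$ Here $H_{\min}^{\bar\varepsilon}(\rho_{XBC}|XC)$ is the smooth min-entropy of $\rho_{XBC}$, regarded as an operator on $\mathcal H_B\otimes(\mathcal H_X\otimes\mathcal H_C)$, given the second factor $\mathcal H_X\otimes\mathcal H_C$. -/

import Mathlib

open scoped ENNReal MatrixOrder ComplexOrder Kronecker

noncomputable section

/-! Operators on a finite-dimensional Hilbert space with an orthonormal basis indexed by a finite
type `n` are complex matrices indexed by `n`; the tensor product of the spaces for `a` and `b` is
indexed by `a × b`, and non-negative operators are the matrices satisfying `Matrix.PosSemidef`. -/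

namespace SmoothEntropy

/-- A density operator: a non-negative operator of trace one. -/
structure IsDensityOperator {n : Type*} [Fintype n] (ρ : Matrix n n ℂ) : Prop where
  posSemidef : ρ.PosSemidef
  trace_eq_one : ρ.trace = 1

/-- The partial trace `Tr_A` over the first tensor factor. -/
def partialTraceLeft {a b : Type*} [Fintype a] (M : Matrix (a × b) (a × b) ℂ) : Matrix b b ℂ :=
  Matrix.of fun i j => ∑ k : a, M (k, i) (k, j)

/-- The partial trace `Tr_B` over the second tensor factor. -/
def partialTraceRight {a b : Type*} [Fintype b] (M : Matrix (a × b) (a × b) ℂ) : Matrix a a ℂ :=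
  Matrix.of fun i j => ∑ k : b, M (i, k) (j, k)

/-- An operator on `H_X ⊗ H_B ⊗ H_C`, regarded as an operator on `H_B ⊗ (H_X ⊗ H_C)`. -/
def reorder {x b c : Type*} (M : Matrix (x × b × c) (x × b × c) ℂ) :
    Matrix (b × x × c) (b × x × c) ℂ :=
  M.submatrix (fun p => (p.2.1, p.1, p.2.2)) (fun p => (p.2.1, p.1, p.2.2))

/-- `ρ` on `H_X ⊗ H_A` is classical on `H_X`:
`ρ = ∑ x, P x • |e x⟩⟨e x| ⊗ τ x` for some orthonormal basis `e` of `H_X`, some non-negative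
function `P` and some non-negative operators `τ x` on `H_A`. -/
def IsClassicalLeft {x a : Type*} [Fintype x] (ρ : Matrix (x × a) (x × a) ℂ) : Prop :=
  ∃ (e : OrthonormalBasis x ℂ (EuclideanSpace ℂ x)) (P : x → ℝ) (τ : x → Matrix a a ℂ),
    (∀ i, 0 ≤ P i) ∧ (∀ i, (τ i).PosSemidef) ∧
      ρ = ∑ i : x, (P i : ℂ) • (Matrix.vecMulVec (⇑(e i)) (star (⇑(e i))) ⊗ₖ τ i)

/-- The trace norm `‖A‖ = Tr |A|`, where `|A| = √(A* A)`. -/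
def traceNorm {n : Type*} [Fintype n] [DecidableEq n] (A : Matrix n n ℂ) : ℝ :=
  (CFC.sqrt (star A * A)).trace.re

/-- The logarithm to base two on `[0, ∞]`, with `log 0 = -∞` and `log ∞ = ∞`. -/
def log2 (t : ℝ≥0∞) : EReal :=
  ENNReal.log t / ((Real.log 2 : ℝ) : EReal)

/-- The min-entropy `H_min(ρ_AB | σ_B) = -log λ`, with `λ` the least real number such that
`λ • id_A ⊗ σ_B - ρ_AB ≥ 0`. If there is no such number, the infimum is `∞` and the value `-∞`. -/
def minEntropyRel {a b : Type*} [DecidableEq a]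
    (ρ : Matrix (a × b) (a × b) ℂ) (σ : Matrix b b ℂ) : EReal :=
  -log2 (⨅ (l : ℝ) (_ : ((l : ℂ) • ((1 : Matrix a a ℂ) ⊗ₖ σ) - ρ).PosSemidef), ENNReal.ofReal l)

/-- The max-entropy `H_max(ρ_A) = log rank ρ_A`. -/
def maxEntropy {a : Type*} [Fintype a] (ρ : Matrix a a ℂ) : EReal :=
  log2 (ρ.rank : ℝ≥0∞)

/-- The set `B^ε(ρ)` of non-negative operators `ρ'` with `‖ρ' - ρ‖ ≤ (Tr ρ) ε`. -/
def ball {n : Type*} [Fintype n] [DecidableEq n] (ε : ℝ) (ρ : Matrix n n ℂ) :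
    Set (Matrix n n ℂ) :=
  {ρ' | ρ'.PosSemidef ∧ traceNorm (ρ' - ρ) ≤ ρ.trace.re * ε}

/-- The smooth min-entropy `H_min^ε(ρ_AB | σ_B)`. -/
def smoothMinEntropyRel {a b : Type*} [Fintype a] [DecidableEq a] [Fintype b] [DecidableEq b]
    (ε : ℝ) (ρ : Matrix (a × b) (a × b) ℂ) (σ : Matrix b b ℂ) : EReal :=
  ⨆ ρ' ∈ ball ε ρ, minEntropyRel ρ' σ

/-- The conditional smooth min-entropy `H_min^ε(ρ_AB | B)`, where `B` is the second factor. -/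
def smoothMinEntropy {a b : Type*} [Fintype a] [DecidableEq a] [Fintype b] [DecidableEq b]
    (ε : ℝ) (ρ : Matrix (a × b) (a × b) ℂ) : EReal :=
  ⨆ (σ : Matrix b b ℂ) (_ : IsDensityOperator σ), smoothMinEntropyRel ε ρ σ

end SmoothEntropy

end

/-!
Write `ρ_BC = Tr_X ρ`, and let `ρ'` be non-negative with `‖ρ' - ρ_BC‖ ≤ ε` and
`ρ' ≤ l • (1 ⊗ σ)`. The state smoothing `ρ` is `(1_X ⊗ T) ρ (1_X ⊗ T)*`, where `T` acts on
`H_B ⊗ H_C` and carries `ρ_BC` below `ρ'` (`exists_conj_le`): with `S = ρ' + |ρ' - ρ_BC| ≥ ρ_BC`,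
the contraction `T = √ρ' S^(-1/2)` satisfies `T ρ_BC T* ≤ T S T* ≤ ρ'`.

* Distance. Since `1 - Re T ≥ 0` and `ρ_BC ≤ S`,
  `Re Tr (1 - T) ρ_BC ≤ Tr S - Tr √ρ' √S ≤ Tr S - Tr ρ' = ‖ρ' - ρ_BC‖ ≤ ε`, by operator
  monotonicity of the square root. The number `Tr (1 - T) ρ_BC` is also `Tr (1 - 1_X ⊗ T) ρ`, and a
  form of the gentle measurement lemma (`traceNorm_conj_sub_le`) turns this bound into
  `‖(1_X ⊗ T) ρ (1_X ⊗ T)* - ρ‖ ≤ √(8 ε)`. No purification is needed.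
* Entropy. Classicality gives `ρ ≤ Π ⊗ ρ_BC`, with `Π` the projection onto the support of `ρ_X`
  (`IsClassicalLeft.exists_le_kronecker`). Conjugating by `1_X ⊗ T` gives
  `(1_X ⊗ T) ρ (1_X ⊗ T)* ≤ Π ⊗ ρ' ≤ l r • (1_B ⊗ (Π / r ⊗ σ))`, where `r` is the rank of `Π` and
  `Π / r ⊗ σ` is a density operator. So the min-entropy drops by at most `log r`.
-/

namespace SmoothEntropy

open Matrix

/-! ### Traces of products of non-negative matrices -/

section Trace

variable {n : Type*} [Fintype n]

lemma re_trace_nonneg {A : Matrix n n ℂ} (hA : A.PosSemidef) : 0 ≤ A.trace.re :=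
  (Complex.le_def.mp hA.trace_nonneg).1

lemma re_trace_mono {A B : Matrix n n ℂ} (h : A ≤ B) : A.trace.re ≤ B.trace.re := by
  have := re_trace_nonneg (Matrix.le_iff.mp h)
  rw [trace_sub, Complex.sub_re] at this
  linarith

lemma re_trace_mul_nonneg [DecidableEq n] {A B : Matrix n n ℂ} (hA : 0 ≤ A) (hB : 0 ≤ B) :
    0 ≤ (A * B).trace.re := by
  have h : (A * B).trace = (CFC.sqrt A * B * star (CFC.sqrt A)).trace := by
    rw [(CFC.sqrt_nonneg A).isSelfAdjoint.star_eq, trace_mul_comm (CFC.sqrt A * B), ← mul_assoc,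
      CFC.sqrt_mul_sqrt_self A hA]
  rw [h]
  exact re_trace_nonneg (nonneg_iff_posSemidef.mp (star_right_conjugate_nonneg hB _))

lemma re_trace_conjTranspose (A : Matrix n n ℂ) : Aᴴ.trace.re = A.trace.re := by
  simp [trace_conjTranspose]

/-- The Cauchy–Schwarz inequality for the Hilbert–Schmidt inner product. -/
lemma re_trace_conjTranspose_mul_le (A B : Matrix n n ℂ) :
    (Aᴴ * B).trace.re ≤ √(Aᴴ * A).trace.re * √(Bᴴ * B).trace.re := by
  let v : Matrix n n ℂ → EuclideanSpace ℂ (n × n) := fun M => WithLp.toLp 2 fun p => M p.2 p.1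
  have hv : ∀ M N, (Mᴴ * N).trace = inner ℂ (v M) (v N) := fun M N => by
    simp [v, trace, mul_apply, PiLp.inner_apply, Fintype.sum_prod_type, mul_comm]
  have hn : ∀ M, √(Mᴴ * M).trace.re = ‖v M‖ := fun M => by
    rw [hv, norm_eq_sqrt_re_inner (𝕜 := ℂ)]
    rfl
  rw [hn, hn, hv]
  exact (Complex.re_le_norm _).trans (norm_inner_le_norm _ _)

end Trace

/-! ### The trace norm and the gentle measurement lemma -/

section TraceNorm

variable {n : Type*} [Fintype n] [DecidableEq n]

lemma continuousOn_spectrum (A : Matrix n n ℂ) (f : ℝ → ℝ) : ContinuousOn f (spectrum ℝ A) :=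
  (Matrix.finite_real_spectrum (A := A)).continuousOn f

/-- The supremum defining the dual form of the trace norm is attained by the sign of the matrix. -/
lemma exists_traceNorm_eq {A : Matrix n n ℂ} (hA : A.IsHermitian) :
    ∃ V : Matrix n n ℂ, V.IsHermitian ∧ V * V ≤ 1 ∧ traceNorm A = (V * A).trace.re := by
  have hA' : IsSelfAdjoint A := hA
  have hc := continuousOn_spectrum A
  refine ⟨cfc Real.sign A, cfc_predicate _ A, ?_, ?_⟩
  · rw [← cfc_mul _ _ A (hc _) (hc _)]
    refine cfc_le_one _ _ fun t _ => ?_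
    obtain h | h | h := Real.sign_apply_eq t <;> simp [h]
  · have h : cfc Real.sign A * A = CFC.abs A := by
      rw [CFC.abs_eq_cfc_norm A]
      nth_rw 2 [← cfc_id ℝ A]
      rw [← cfc_mul _ _ A (hc _) (hc _)]
      refine cfc_congr fun t _ => ?_
      obtain h | h | h := lt_trichotomy t 0
      · simp [Real.sign_of_neg h, abs_of_neg h]
      · simp [h]
      · simp [Real.sign_of_pos h, abs_of_pos h]
    rw [h]
    rfl

/-- The gentle measurement lemma, for operators `T` that need not be positive: the proof splits
`T ρ T* - ρ` as `(T - 1) ρ T* + ρ (T - 1)*` and applies the Cauchy–Schwarz inequality to each part,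
using that `Tr (T - 1) ρ (T - 1)* ≤ 2 δ`. -/
lemma traceNorm_conj_sub_le {ρ T : Matrix n n ℂ} (hρ : IsDensityOperator ρ) {δ : ℝ}
    (hT : (T * ρ * Tᴴ).trace.re ≤ 1) (hδ : 1 - (T * ρ).trace.re ≤ δ) :
    traceNorm (T * ρ * Tᴴ - ρ) ≤ √(8 * δ) := by
  obtain ⟨hps, htr⟩ := hρ
  have h0 : 0 ≤ ρ := nonneg_iff_posSemidef.mpr hps
  set s := CFC.sqrt ρ with hs
  have hss : s * s = ρ := CFC.sqrt_mul_sqrt_self ρ h0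
  have hsH : sᴴ = s := (CFC.sqrt_nonneg ρ).isSelfAdjoint.star_eq
  obtain ⟨V, hV, hV1, hVn⟩ := exists_traceNorm_eq (A := T * ρ * Tᴴ - ρ)
    ((hps.mul_mul_conjTranspose_same T).isHermitian.sub hps.isHermitian)
  set D := (T - 1) * s with hD
  have hre : ρ.trace.re = 1 := by rw [htr]; rfl
  have hadj : (ρ * Tᴴ).trace.re = (T * ρ).trace.re := by
    rw [← re_trace_conjTranspose (T * ρ), conjTranspose_mul, hps.isHermitian.eq]
  have hDD : (Dᴴ * D).trace.re ≤ 2 * δ := by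
    have : (Dᴴ * D).trace = (T * ρ * Tᴴ).trace - (T * ρ).trace - (ρ * Tᴴ).trace + ρ.trace := by
      rw [trace_mul_comm]
      have : D * Dᴴ = T * ρ * Tᴴ - T * ρ - ρ * Tᴴ + ρ := by
        rw [hD, conjTranspose_mul, hsH, ← hss, conjTranspose_sub, conjTranspose_one]
        noncomm_ring
      rw [this, trace_add, trace_sub, trace_sub]
    rw [this]
    simp only [Complex.add_re, Complex.sub_re]
    linarith
  have hVD : ((V * D)ᴴ * (V * D)).trace.re ≤ 2 * δ := by
    refine le_trans ?_ hDD
    have h := re_trace_mono (star_left_conjugate_le_conjugate hV1 D)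
    rw [star_eq_conjTranspose, mul_one] at h
    rw [conjTranspose_mul, hV.eq]
    simpa only [mul_assoc] using h
  have hTs : ((T * s)ᴴ * (T * s)).trace.re ≤ 1 := by
    rwa [trace_mul_comm, conjTranspose_mul, hsH, ← mul_assoc, mul_assoc T s s, hss]
  have hsq : (sᴴ * s).trace.re ≤ 1 := by rw [hsH, hss, hre]
  have key : ∀ A B : Matrix n n ℂ, (Aᴴ * A).trace.re ≤ 1 → (Bᴴ * B).trace.re ≤ 2 * δ →
      (Aᴴ * B).trace.re ≤ √(2 * δ) := fun A B hA hB => by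
    refine (re_trace_conjTranspose_mul_le A B).trans ?_
    have h1 : √(Aᴴ * A).trace.re ≤ 1 := Real.sqrt_le_one.mpr hA
    have h2 := Real.sqrt_le_sqrt hB
    nlinarith [Real.sqrt_nonneg (Bᴴ * B).trace.re, Real.sqrt_nonneg (Aᴴ * A).trace.re]
  have e1 : (V * (T * ρ * Tᴴ - ρ)).trace.re =
      ((T * s)ᴴ * (V * D)).trace.re + (sᴴ * (V * D)).trace.re := by
    have a1 : ((T * s)ᴴ * (V * D)).trace = (V * ((T - 1) * ρ * Tᴴ)).trace := by
      rw [trace_mul_comm, hD, conjTranspose_mul, hsH, ← hss]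
      simp only [mul_assoc]
    have a2 : (sᴴ * (V * D)).trace.re = (V * (ρ * (T - 1)ᴴ)).trace.re := by
      rw [trace_mul_comm, hD, hsH, ← re_trace_conjTranspose, mul_assoc, mul_assoc, hss,
        conjTranspose_mul, conjTranspose_mul, hV.eq, hps.isHermitian.eq, trace_mul_comm]
    rw [a1, a2, ← Complex.add_re, ← trace_add, ← mul_add]
    congr 3
    rw [conjTranspose_sub, conjTranspose_one]
    noncomm_ring
  have h8 : √(8 * δ) = 2 * √(2 * δ) := by
    rw [show 8 * δ = 2 ^ 2 * (2 * δ) by ring, Real.sqrt_mul (by norm_num),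
      Real.sqrt_sq (by norm_num)]
  rw [hVn, e1, h8]
  linarith [key _ _ hTs hVD, key _ _ hsq hVD]

end TraceNorm

/-! ### A contraction carrying one non-negative matrix below another -/

section Contraction

variable {n : Type*} [Fintype n] [DecidableEq n]

open scoped Matrix.Norms.L2Operator in
/-- The square root is operator monotone. -/
lemma matrix_sqrt_le_sqrt {A B : Matrix n n ℂ} (h : A ≤ B) : CFC.sqrt A ≤ CFC.sqrt B :=
  CFC.sqrt_le_sqrt A B h

/-- For `S ≥ 0` there is `R = S^(-1/2)`, the inverse being taken on the support of `S`. -/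
lemma exists_pinv_sqrt {S : Matrix n n ℂ} (hS : 0 ≤ S) :
    ∃ R : Matrix n n ℂ, R.IsHermitian ∧ R * S = CFC.sqrt S ∧ R * S * R ≤ 1 := by
  have hS' : IsSelfAdjoint S := hS.isSelfAdjoint
  have hc := continuousOn_spectrum S
  have hn : ∀ t ∈ spectrum ℝ S, 0 ≤ t := fun t ht => spectrum_nonneg_of_nonneg hS ht
  set R := cfc (fun t : ℝ => (√t)⁻¹) S with hR
  have hRS : R * S = cfc (fun t : ℝ => √t) S := by
    conv_lhs => rw [hR]; arg 2; rw [← cfc_id ℝ S]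
    rw [← cfc_mul _ _ S (hc _) (hc _)]
    refine cfc_congr fun t ht => ?_
    simp only [id]
    rw [← Real.mul_self_sqrt (hn t ht), Real.sqrt_mul_self (Real.sqrt_nonneg t)]
    by_cases h : √t = 0
    · simp [h]
    · field_simp
  have hRSR : R * S * R = cfc (fun t : ℝ => √t * (√t)⁻¹) S := by
    rw [hRS, hR, ← cfc_mul _ _ S (hc _) (hc _)]
  refine ⟨R, cfc_predicate _ S, ?_, ?_⟩
  · rw [hRS, CFC.sqrt_eq_real_sqrt S hS, cfcₙ_eq_cfc Real.continuous_sqrt.continuousOn Real.sqrt_zero]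
  · rw [hRSR]
    exact cfc_le_one _ _ fun t _ => mul_inv_le_one

/-- Given non-negative `ρ` and `ρ'`, the contraction `T = √ρ' S^(-1/2)` with
`S = ρ' + |ρ' - ρ| ≥ ρ` carries `ρ` below `ρ'` and is close to the identity on `ρ`. -/
lemma exists_conj_le {ρ ρ' : Matrix n n ℂ} (hρ : 0 ≤ ρ) (hρ' : 0 ≤ ρ') :
    ∃ T : Matrix n n ℂ, T * ρ * Tᴴ ≤ ρ' ∧ (T * ρ * Tᴴ).trace.re ≤ ρ.trace.re ∧
      ρ.trace.re - (T * ρ).trace.re ≤ traceNorm (ρ' - ρ) := by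
  set Δ := CFC.abs (ρ' - ρ) with hΔ
  have hsa : IsSelfAdjoint (ρ' - ρ) := hρ'.isSelfAdjoint.sub hρ.isSelfAdjoint
  have hΔ0 : 0 ≤ Δ := CFC.abs_nonneg _
  have hΔtr : Δ.trace.re = traceNorm (ρ' - ρ) := rfl
  set S := ρ' + Δ with hSdef
  have hρ'S : ρ' ≤ S := le_add_of_nonneg_right hΔ0
  have hS : 0 ≤ S := hρ'.trans hρ'S
  have hρS : ρ ≤ S := by
    -- `|A| + A` is twice the positive part of `A`
    have h : 0 ≤ Δ + (ρ' - ρ) := by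
      rw [hΔ, CFC.abs_add_self (ρ' - ρ) hsa]
      exact nsmul_nonneg (CFC.posPart_nonneg _) 2
    have h2 : S - ρ = Δ + (ρ' - ρ) := by rw [hSdef]; abel
    rwa [← sub_nonneg, h2]
  obtain ⟨R, hRH, hRS, hP1⟩ := exists_pinv_sqrt hS
  set s := CFC.sqrt ρ' with hs
  have hss : s * s = ρ' := CFC.sqrt_mul_sqrt_self ρ' hρ'
  have hsH : sᴴ = s := (CFC.sqrt_nonneg ρ').isSelfAdjoint.star_eq
  have hRstar : star R = R := hRH
  have hsstar : star s = s := hsH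
  have hTH : (s * R)ᴴ = R * s := by rw [conjTranspose_mul, hsH, hRH.eq]
  have hconj : ∀ A B : Matrix n n ℂ, A ≤ B → s * R * A * (R * s) ≤ s * R * B * (R * s) :=
    fun A B h => by
      have := star_right_conjugate_le_conjugate h (s * R)
      rwa [star_eq_conjTranspose, hTH] at this
  have hTT : (s * R)ᴴ * (s * R) ≤ 1 := by
    have h := star_right_conjugate_le_conjugate hρ'S R
    rw [hRstar] at h
    rw [hTH]
    calc R * s * (s * R) = R * ρ' * R := by rw [← hss]; simp only [mul_assoc]
      _ ≤ R * S * R := h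
      _ ≤ 1 := hP1
  refine ⟨s * R, ?_, ?_, ?_⟩
  · rw [hTH]
    calc s * R * ρ * (R * s) ≤ s * R * S * (R * s) := hconj _ _ hρS
      _ = s * (R * S * R) * s := by simp only [mul_assoc]
      _ ≤ s * 1 * s := by
          have h := star_right_conjugate_le_conjugate hP1 s
          rwa [hsstar] at h
      _ = ρ' := by rw [mul_one, hss]
  · rw [mul_assoc, trace_mul_comm, mul_assoc]
    have h := re_trace_mul_nonneg hρ (sub_nonneg.mpr hTT)
    rw [mul_sub, mul_one, trace_sub, Complex.sub_re] at h
    linarith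
  · -- `1 - Re T` is non-negative, so `ρ` may be replaced by `S`
    have h1 : ((s * R) * (S - ρ)).trace.re ≤ (S - ρ).trace.re := by
      -- `(1 - T)* (1 - T) + (1 - T* T) = 2 (1 - Re T)`
      have hpos : 0 ≤ star (1 - s * R) * (1 - s * R) + (1 - (s * R)ᴴ * (s * R)) :=
        add_nonneg (star_mul_self_nonneg _) (sub_nonneg.mpr hTT)
      have h := re_trace_mul_nonneg hpos (sub_nonneg.mpr hρS)
      have hexp : (star (1 - s * R) * (1 - s * R) + (1 - (s * R)ᴴ * (s * R))) * (S - ρ) =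
          (S - ρ) + (S - ρ) - (s * R) * (S - ρ) - (s * R)ᴴ * (S - ρ) := by
        rw [star_sub, star_one, star_eq_conjTranspose]
        noncomm_ring
      have hadj : ((s * R)ᴴ * (S - ρ)).trace.re = ((s * R) * (S - ρ)).trace.re := by
        rw [← re_trace_conjTranspose, conjTranspose_mul, conjTranspose_conjTranspose,
          (Matrix.le_iff.mp hρS).isHermitian.eq, trace_mul_comm]
      rw [hexp, trace_sub, trace_sub, trace_add, Complex.sub_re, Complex.sub_re, Complex.add_re,
        hadj] at h
      linarith
    have h2 : ρ'.trace.re ≤ (s * R * S).trace.re := by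
      have h := re_trace_mul_nonneg (CFC.sqrt_nonneg ρ')
        (sub_nonneg.mpr (matrix_sqrt_le_sqrt hρ'S))
      rw [← hs, mul_sub, hss, trace_sub, Complex.sub_re, ← hRS, ← mul_assoc] at h
      linarith
    have h3 : S.trace.re = ρ'.trace.re + Δ.trace.re := by rw [hSdef, trace_add, Complex.add_re]
    rw [mul_sub, trace_sub, trace_sub, Complex.sub_re, Complex.sub_re] at h1
    linarith

end Contraction

/-! ### Partial traces and Kronecker products -/

section PartialTrace

variable {a b : Type*}

lemma partialTraceLeft_kronecker [Fintype a] (A : Matrix a a ℂ) (B : Matrix b b ℂ) :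
    partialTraceLeft (A ⊗ₖ B) = A.trace • B := by
  ext i j
  simp [partialTraceLeft, trace, Finset.sum_mul]

lemma partialTraceRight_kronecker [Fintype b] (A : Matrix a a ℂ) (B : Matrix b b ℂ) :
    partialTraceRight (A ⊗ₖ B) = B.trace • A := by
  ext i j
  simp [partialTraceRight, trace, ← Finset.mul_sum, mul_comm]

lemma partialTraceLeft_sum_smul [Fintype a] {ι : Type*} (s : Finset ι) (c : ι → ℂ)
    (M : ι → Matrix (a × b) (a × b) ℂ) :
    partialTraceLeft (∑ i ∈ s, c i • M i) = ∑ i ∈ s, c i • partialTraceLeft (M i) := by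
  ext i j
  simp only [partialTraceLeft, of_apply, Matrix.sum_apply, Matrix.smul_apply, Finset.smul_sum]
  exact Finset.sum_comm

lemma partialTraceRight_sum_smul [Fintype b] {ι : Type*} (s : Finset ι) (c : ι → ℂ)
    (M : ι → Matrix (a × b) (a × b) ℂ) :
    partialTraceRight (∑ i ∈ s, c i • M i) = ∑ i ∈ s, c i • partialTraceRight (M i) := by
  ext i j
  simp only [partialTraceRight, of_apply, Matrix.sum_apply, Matrix.smul_apply, Finset.smul_sum]
  exact Finset.sum_comm

lemma partialTraceLeft_posSemidef [Fintype a] {M : Matrix (a × b) (a × b) ℂ}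
    (hM : M.PosSemidef) : (partialTraceLeft M).PosSemidef := by
  have h : partialTraceLeft M = ∑ k, M.submatrix (Prod.mk k) (Prod.mk k) := by
    ext i j
    simp [partialTraceLeft, Matrix.sum_apply]
  rw [h]
  exact posSemidef_sum _ fun k _ => hM.submatrix _

variable [Fintype a] [Fintype b]

lemma trace_partialTraceLeft (M : Matrix (a × b) (a × b) ℂ) :
    (partialTraceLeft M).trace = M.trace := by
  simp only [partialTraceLeft, trace, diag, of_apply, Fintype.sum_prod_type]
  exact Finset.sum_comm

lemma partialTraceLeft_one_kronecker_mul [DecidableEq a] (T : Matrix b b ℂ)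
    (M : Matrix (a × b) (a × b) ℂ) :
    partialTraceLeft (((1 : Matrix a a ℂ) ⊗ₖ T) * M) = T * partialTraceLeft M := by
  ext i j
  simp only [partialTraceLeft, of_apply, mul_apply, kroneckerMap_apply, Fintype.sum_prod_type,
    one_apply, ite_mul, one_mul, zero_mul, Finset.sum_ite_irrel, Finset.sum_const_zero,
    Finset.sum_ite_eq, Finset.mem_univ, if_true, Finset.mul_sum]
  exact Finset.sum_comm

lemma partialTraceLeft_mul_one_kronecker [DecidableEq a] (T : Matrix b b ℂ)
    (M : Matrix (a × b) (a × b) ℂ) :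
    partialTraceLeft (M * ((1 : Matrix a a ℂ) ⊗ₖ T)) = partialTraceLeft M * T := by
  ext i j
  simp only [partialTraceLeft, of_apply, mul_apply, kroneckerMap_apply, Fintype.sum_prod_type,
    one_apply, ite_mul, mul_ite, one_mul, mul_zero, zero_mul, Finset.sum_ite_irrel,
    Finset.sum_const_zero, Finset.sum_ite_eq', Finset.mem_univ, if_true, Finset.sum_mul]
  rw [Finset.sum_comm]

lemma kronecker_mono_right [DecidableEq a] [DecidableEq b] {A : Matrix a a ℂ} (hA : A.PosSemidef)
    {B C : Matrix b b ℂ} (h : B ≤ C) : A ⊗ₖ B ≤ A ⊗ₖ C := by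
  rw [Matrix.le_iff] at h ⊢
  have : A ⊗ₖ C - A ⊗ₖ B = A ⊗ₖ (C - B) := by
    ext
    simp [mul_sub]
  rw [this]
  exact hA.kronecker h

end PartialTrace

/-! ### Reordering tensor factors -/

section Reorder

variable {x b c : Type*}

/-- The bijection of index sets underlying `reorder`. -/
def reorderEquiv : b × x × c ≃ x × b × c where
  toFun p := (p.2.1, p.1, p.2.2)
  invFun p := (p.2.1, p.1, p.2.2)

lemma reorder_eq (M : Matrix (x × b × c) (x × b × c) ℂ) :
    reorder M = M.submatrix reorderEquiv reorderEquiv := rfl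

lemma reorder_kronecker_one_kronecker [DecidableEq b] (A : Matrix x x ℂ) (B : Matrix c c ℂ) :
    reorder (A ⊗ₖ ((1 : Matrix b b ℂ) ⊗ₖ B)) = (1 : Matrix b b ℂ) ⊗ₖ (A ⊗ₖ B) := by
  ext i j
  simp [reorder, mul_left_comm]

lemma reorder_mono {M N : Matrix (x × b × c) (x × b × c) ℂ} (h : M ≤ N) :
    reorder M ≤ reorder N := by
  rw [Matrix.le_iff] at h ⊢
  exact h.submatrix reorderEquiv

variable [Fintype x] [Fintype b] [Fintype c]

lemma trace_reorder (M : Matrix (x × b × c) (x × b × c) ℂ) : (reorder M).trace = M.trace :=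
  Fintype.sum_equiv reorderEquiv _ _ fun _ => rfl

lemma reorder_mul (M N : Matrix (x × b × c) (x × b × c) ℂ) :
    reorder (M * N) = reorder M * reorder N := by
  simp only [reorder_eq, submatrix_mul_equiv]

end Reorder

/-! ### Operators that are classical on the first factor -/

section Classical

variable {x a : Type*} [Fintype x]

/-- The rank-one projection `|e i⟩⟨e i|`. -/
noncomputable def basisProj (e : OrthonormalBasis x ℂ (EuclideanSpace ℂ x)) (i : x) : Matrix x x ℂ :=
  vecMulVec (⇑(e i)) (star (⇑(e i)))

lemma basisProj_posSemidef (e : OrthonormalBasis x ℂ (EuclideanSpace ℂ x)) (i : x) :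
    (basisProj e i).PosSemidef :=
  posSemidef_vecMulVec_self_star _

variable [DecidableEq x]

lemma star_dotProduct_basis (e : OrthonormalBasis x ℂ (EuclideanSpace ℂ x)) (i j : x) :
    star (⇑(e i)) ⬝ᵥ ⇑(e j) = if i = j then 1 else 0 := by
  rw [← orthonormal_iff_ite.mp e.orthonormal i j, EuclideanSpace.inner_eq_star_dotProduct,
    dotProduct_comm]

lemma trace_basisProj (e : OrthonormalBasis x ℂ (EuclideanSpace ℂ x)) (i : x) :
    (basisProj e i).trace = 1 := by
  rw [basisProj, trace_vecMulVec, dotProduct_comm, star_dotProduct_basis, if_pos rfl]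

/-- A combination of the projections onto the vectors of an orthonormal basis has rank at least the
number of its nonzero coefficients. -/
lemma card_le_rank_sum_basisProj (e : OrthonormalBasis x ℂ (EuclideanSpace ℂ x)) (q : x → ℂ)
    (I : Finset x) (hI : ∀ i ∈ I, q i ≠ 0) : I.card ≤ (∑ i, q i • basisProj e i).rank := by
  set M := ∑ i, q i • basisProj e i with hM
  have hmul : ∀ j, M *ᵥ ⇑(e j) = q j • ⇑(e j) := fun j => by
    rw [hM, sum_mulVec, Finset.sum_eq_single j]
    · rw [smul_mulVec, basisProj, vecMulVec_mulVec, star_dotProduct_basis, if_pos rfl]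
      simp
    · intro i _ hij
      rw [smul_mulVec, basisProj, vecMulVec_mulVec, star_dotProduct_basis, if_neg hij]
      simp
    · simp
  have hmem : ∀ j : I, (⇑(e j) : x → ℂ) ∈ LinearMap.range M.mulVecLin := fun j => by
    refine ⟨(q j)⁻¹ • ⇑(e j), ?_⟩
    rw [mulVecLin_apply, mulVec_smul, hmul, smul_smul, inv_mul_cancel₀ (hI j j.2), one_smul]
  have hli : LinearIndependent ℂ fun j : I => (⇑(e j) : x → ℂ) :=
    ((e.orthonormal.linearIndependent.comp _ Subtype.val_injective).map'
      (WithLp.linearEquiv 2 ℂ (x → ℂ)).toLinearMap (LinearEquiv.ker _) :)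
  have hli' : LinearIndependent ℂ fun j : I => (⟨_, hmem j⟩ : LinearMap.range M.mulVecLin) :=
    LinearIndependent.of_comp (LinearMap.range M.mulVecLin).subtype hli
  simpa [Matrix.rank] using hli'.fintype_card_le_finrank

/-- An operator that is classical on `H_X` lies below `Π ⊗ Tr_X ρ` for an operator `Π ≥ 0` (the
projection onto the support of `Tr_A ρ`) whose trace is at most the rank of `Tr_A ρ`. -/
lemma IsClassicalLeft.exists_le_kronecker [Fintype a] [DecidableEq a] {ρ : Matrix (x × a) (x × a) ℂ}
    (hcl : IsClassicalLeft ρ) :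
    ∃ (Q : Matrix x x ℂ) (r : ℕ), Q.PosSemidef ∧ Q.trace = r ∧
      r ≤ (partialTraceRight ρ).rank ∧ ρ ≤ Q ⊗ₖ partialTraceLeft ρ := by
  classical
  obtain ⟨e, P, τ, hP, hτ, rfl⟩ := hcl
  change ∃ (Q : Matrix x x ℂ) (r : ℕ), Q.PosSemidef ∧ Q.trace = r ∧
      r ≤ (partialTraceRight (∑ i, (P i : ℂ) • basisProj e i ⊗ₖ τ i)).rank ∧
      ∑ i, (P i : ℂ) • basisProj e i ⊗ₖ τ i ≤
        Q ⊗ₖ partialTraceLeft (∑ i, (P i : ℂ) • basisProj e i ⊗ₖ τ i)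
  have hPτ : ∀ i, ((P i : ℂ) • τ i).PosSemidef := fun i =>
    (hτ i).smul (by exact_mod_cast hP i)
  -- the projections with nonzero weight span the support of `Tr_A ρ`
  set I : Finset x := Finset.univ.filter fun i => (P i : ℂ) • τ i ≠ 0 with hI
  refine ⟨∑ i ∈ I, basisProj e i, I.card, posSemidef_sum _ fun i _ => basisProj_posSemidef e i,
    ?_, ?_, ?_⟩
  · simp [trace_sum, trace_basisProj]
  · simp only [partialTraceRight_sum_smul, partialTraceRight_kronecker, smul_smul]
    refine card_le_rank_sum_basisProj e _ I fun i hi h => ?_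
    refine (Finset.mem_filter.mp hi).2 ((hPτ i).trace_eq_zero_iff.mp ?_)
    rw [trace_smul, smul_eq_mul, h]
  · have hleft : partialTraceLeft (∑ i, (P i : ℂ) • basisProj e i ⊗ₖ τ i) =
        ∑ i, (P i : ℂ) • τ i := by
      simp only [partialTraceLeft_sum_smul, partialTraceLeft_kronecker, trace_basisProj, one_smul]
    have hsum : ∑ i, (P i : ℂ) • basisProj e i ⊗ₖ τ i =
        ∑ i ∈ I, basisProj e i ⊗ₖ ((P i : ℂ) • τ i) := by
      simp only [← kronecker_smul]
      refine (Finset.sum_subset (Finset.subset_univ I) fun i _ hi => ?_).symm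
      have h0 : (P i : ℂ) • τ i = 0 := by
        by_contra h0
        exact hi (Finset.mem_filter.mpr ⟨Finset.mem_univ i, h0⟩)
      rw [h0, kronecker_zero]
    have hdist : ∀ N : Matrix a a ℂ, (∑ i ∈ I, basisProj e i) ⊗ₖ N =
        ∑ i ∈ I, basisProj e i ⊗ₖ N := fun N => by
      ext
      simp [Matrix.sum_apply, Finset.sum_mul]
    rw [hleft, hsum, hdist]
    refine Finset.sum_le_sum fun i _ => kronecker_mono_right (basisProj_posSemidef e i) ?_
    exact Finset.single_le_sum (f := fun i => (P i : ℂ) • τ i)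
      (fun j _ => nonneg_iff_posSemidef.mpr (hPτ j)) (Finset.mem_univ i)

end Classical

/-! ### Logarithms and min-entropies in the extended reals -/

section Entropy

lemma log2_mono {s t : ℝ≥0∞} (h : s ≤ t) : log2 s ≤ log2 t :=
  EReal.div_le_div_right_of_nonneg (by exact_mod_cast Real.log_nonneg one_le_two)
    (ENNReal.log_le_log h)

lemma log2_mul (s t : ℝ≥0∞) : log2 (s * t) = log2 s + log2 t := by
  have h : (0 : EReal) ≤ (Real.log 2 : ℝ) := by exact_mod_cast Real.log_nonneg one_le_two
  rw [log2, ENNReal.log_mul_add, log2, log2, EReal.div_eq_inv_mul, EReal.div_eq_inv_mul,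
    EReal.div_eq_inv_mul]
  exact EReal.left_distrib_of_nonneg_of_ne_top (EReal.inv_nonneg_of_nonneg h)
    (EReal.inv_lt_top _).ne _ _

lemma exists_log2_natCast {r : ℕ} (hr : r ≠ 0) : ∃ t : ℝ, log2 (r : ℝ≥0∞) = t := by
  refine ⟨Real.log r / Real.log 2, ?_⟩
  rw [log2, ENNReal.log_pos_real (by exact_mod_cast hr) (ENNReal.natCast_ne_top r)]
  simp [EReal.coe_div]

/-- If each feasible `l` for `(ρ, σ)` gives the feasible value `l * r` for `(ρ', σ')`, then the
min-entropy drops by at most `log r`. -/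
lemma minEntropyRel_le_add {a b a' b' : Type*} [DecidableEq a] [DecidableEq a']
    {ρ : Matrix (a × b) (a × b) ℂ} {σ : Matrix b b ℂ} {ρ' : Matrix (a' × b') (a' × b') ℂ}
    {σ' : Matrix b' b' ℂ} {r : ℕ} (hr : r ≠ 0)
    (h : ∀ l : ℝ, ((l : ℂ) • ((1 : Matrix a a ℂ) ⊗ₖ σ) - ρ).PosSemidef →
      (((l * r : ℝ) : ℂ) • ((1 : Matrix a' a' ℂ) ⊗ₖ σ') - ρ').PosSemidef) :
    minEntropyRel ρ σ ≤ minEntropyRel ρ' σ' + log2 r := by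
  set m := ⨅ (l : ℝ) (_ : ((l : ℂ) • ((1 : Matrix a a ℂ) ⊗ₖ σ) - ρ).PosSemidef),
    ENNReal.ofReal l with hm
  have hm' : (⨅ (l : ℝ) (_ : ((l : ℂ) • ((1 : Matrix a' a' ℂ) ⊗ₖ σ') - ρ').PosSemidef),
      ENNReal.ofReal l) ≤ r * m := by
    have hr0 : (r : ℝ≥0∞) ≠ 0 := by exact_mod_cast hr
    rw [hm, ENNReal.mul_iInf_of_ne hr0 (ENNReal.natCast_ne_top r)]
    refine le_iInf fun l => ?_
    rw [ENNReal.mul_iInf_of_ne hr0 (ENNReal.natCast_ne_top r)]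
    refine le_iInf fun hl => (iInf₂_le (l * r) (h l hl)).trans_eq ?_
    rw [mul_comm, ENNReal.ofReal_mul (Nat.cast_nonneg r), ENNReal.ofReal_natCast]
  have h2 := log2_mono hm'
  obtain ⟨t, ht⟩ := exists_log2_natCast hr
  rw [log2_mul, ht] at h2
  rw [ht]
  rw [← EReal.sub_le_iff_le_add (.inl (EReal.coe_ne_bot t)) (.inl (EReal.coe_ne_top t)),
    sub_eq_add_neg, add_comm]
  have h3 := EReal.neg_le_neg_iff.mpr h2
  rwa [EReal.neg_add (.inl (EReal.coe_ne_bot t)) (.inl (EReal.coe_ne_top t)),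
    sub_eq_add_neg] at h3

end Entropy

end SmoothEntropy

/-! ### The chain rule for a classical system -/

theorem mainTheorem4 {x b c : Type*} [Fintype x] [DecidableEq x] [Fintype b] [DecidableEq b]
    [Fintype c] [DecidableEq c] (ρ : Matrix (x × b × c) (x × b × c) ℂ)
    (hρ : SmoothEntropy.IsDensityOperator ρ) (hcl : SmoothEntropy.IsClassicalLeft ρ)
    (ε : ℝ) (hε : 0 ≤ ε) :
    SmoothEntropy.smoothMinEntropy (Real.sqrt (8 * ε)) (SmoothEntropy.reorder ρ) ≥
      SmoothEntropy.smoothMinEntropy ε (SmoothEntropy.partialTraceLeft ρ) -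
        SmoothEntropy.maxEntropy (SmoothEntropy.partialTraceRight ρ) := by
  open SmoothEntropy Matrix in
  obtain ⟨Q, r, hQ, hQtr, hr, hle⟩ := hcl.exists_le_kronecker
  obtain ⟨hps, htr⟩ := hρ
  set ρ₁ := partialTraceLeft ρ with hρ₁
  have hρ₁tr : ρ₁.trace = 1 := by rw [hρ₁, trace_partialTraceLeft, htr]
  have hρ₁0 : 0 ≤ ρ₁ := nonneg_iff_posSemidef.mpr (partialTraceLeft_posSemidef hps)
  -- `r = 0` would force `Q = 0`, hence `ρ = 0`
  have hr0 : r ≠ 0 := by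
    rintro rfl
    have hQ0 : Q = 0 := hQ.trace_eq_zero_iff.mp (by simpa using hQtr)
    have h := re_trace_mono hle
    rw [hQ0, zero_kronecker, htr, trace_zero] at h
    norm_num at h
  have hrank : log2 r ≤ maxEntropy (partialTraceRight ρ) := log2_mono (by exact_mod_cast hr)
  obtain ⟨t, ht⟩ := exists_log2_natCast hr0
  -- `log r` is a real number, so it can be moved across the inequality even at infinite entropies
  refine (EReal.sub_le_sub le_rfl hrank).trans ?_
  rw [ht, EReal.sub_le_iff_le_add (.inl (EReal.coe_ne_bot t)) (.inl (EReal.coe_ne_top t)), ← ht]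
  refine iSup₂_le fun σ hσ => iSup₂_le fun ρ' hρ' => ?_
  obtain ⟨T, hT1, hT2, hT3⟩ := exists_conj_le hρ₁0 (nonneg_iff_posSemidef.mpr hρ'.1)
  have hδ : traceNorm (ρ' - ρ₁) ≤ ε := by simpa [hρ₁tr] using hρ'.2
  set K := (1 : Matrix x x ℂ) ⊗ₖ T with hK
  have hKH : Kᴴ = (1 : Matrix x x ℂ) ⊗ₖ Tᴴ := by
    rw [hK, conjTranspose_kronecker, conjTranspose_one]
  have hrK : (reorder K)ᴴ = reorder Kᴴ := rfl
  have hrconj : reorder K * reorder ρ * (reorder K)ᴴ = reorder (K * ρ * Kᴴ) := by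
    rw [hrK, reorder_mul, reorder_mul]
  -- the normalised projection onto the support of `ρ_X`, tensored with `σ`
  set σ' : Matrix (x × c) (x × c) ℂ := ((r : ℂ)⁻¹ • Q) ⊗ₖ σ with hσ'
  have hσ'd : IsDensityOperator σ' := by
    have hrc : (r : ℂ) ≠ 0 := by exact_mod_cast hr0
    refine ⟨(hQ.smul (by positivity)).kronecker hσ.posSemidef, ?_⟩
    rw [hσ', trace_kronecker, trace_smul, hQtr, hσ.trace_eq_one, smul_eq_mul,
      inv_mul_cancel₀ hrc, one_mul]
  have hball : reorder (K * ρ * Kᴴ) ∈ ball (√(8 * ε)) (reorder ρ) := by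
    have hd : IsDensityOperator (reorder ρ) :=
      ⟨hps.submatrix reorderEquiv, by rw [trace_reorder, htr]⟩
    refine ⟨(hps.mul_mul_conjTranspose_same K).submatrix reorderEquiv, ?_⟩
    rw [hd.trace_eq_one, Complex.one_re, one_mul, ← hrconj]
    refine traceNorm_conj_sub_le hd ?_ ?_
    · rw [hrconj, trace_reorder, ← trace_partialTraceLeft, hKH,
        partialTraceLeft_mul_one_kronecker, partialTraceLeft_one_kronecker_mul]
      simpa [hρ₁tr] using hT2
    · rw [← reorder_mul, trace_reorder, ← trace_partialTraceLeft,
        partialTraceLeft_one_kronecker_mul]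
      refine le_trans ?_ hδ
      simpa [hρ₁tr] using hT3
  have hmain : minEntropyRel ρ' σ ≤ minEntropyRel (reorder (K * ρ * Kᴴ)) σ' + log2 r := by
    refine minEntropyRel_le_add hr0 fun l hl => ?_
    have h1 : K * ρ * Kᴴ ≤ Q ⊗ₖ (T * ρ₁ * Tᴴ) := by
      have h := star_right_conjugate_le_conjugate hle K
      rw [star_eq_conjTranspose] at h
      refine h.trans_eq ?_
      rw [hKH, hK, ← mul_kronecker_mul, ← mul_kronecker_mul, one_mul, mul_one]
    have h2 : K * ρ * Kᴴ ≤ Q ⊗ₖ ((l : ℂ) • ((1 : Matrix b b ℂ) ⊗ₖ σ)) :=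
      h1.trans (kronecker_mono_right hQ (hT1.trans (Matrix.le_iff.mpr hl)))
    refine Matrix.le_iff.mp ((reorder_mono h2).trans_eq ?_)
    have hrc : (r : ℂ) ≠ 0 := by exact_mod_cast hr0
    rw [hσ', smul_kronecker, kronecker_smul, kronecker_smul, smul_smul,
      ← reorder_kronecker_one_kronecker]
    push_cast
    rw [mul_assoc, mul_inv_cancel₀ hrc, mul_one]
    rfl
  refine hmain.trans (add_le_add ?_ le_rfl)
  exact (le_iSup₂_of_le (f := fun ρ' _ => minEntropyRel ρ' σ') _ hball le_rfl).trans
    (le_iSup₂_of_le (f := fun σ _ => smoothMinEntropyRel (√(8 * ε)) (reorder ρ) σ) σ' hσ'd le_rfl)
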